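/- Let $G$ be a real Lie group of dimension $n\ge 2$ with Lie algebra $\mathcal G$. Properties of $G$ such as solvable, $k$-step nilpotent and nondecomposable refer to $\mathcal G$; nondecomposable means that $\mathcal G$ is not the direct sum of two nonzero ideals. For $x\in\mathcal G$ let $x^+$ be the corresponding left invariant vector field. The canonical Cartan--Schouten connection of $G$ is the connection $\nabla$ with $\nabla_{x^+}y^+=\tfrac12[x,y]^+$ for all $x,y\in\mathcal G$. A smooth pseudo-Riemannian metric $\mu$ on $G$ is called a Cartan--Schouten metric if $\nabla\mu=0$, that is, $X\cdot\mu(Y,Z)=\mu(\nabla_XY,Z)+\mu(Y,\nabla_XZ)$ for all vector fields $X,Y,Z$. It is called Lorentzian if, up to an overall sign, it has signature $(1,n-1)$ at every point. **Theorem.** Let $G$ be nondecomposable and solvable, and suppose that $G$ has a Lorentzian Cartan--Schouten metric. Then $G$ is of one of the following types: 1. $\mathcal G$ is nilpotent, of nilpotency class exactly $2$ or exactly $3$; 2. $\mathcal G$ is solvable of derived length exactly $3$, and its derived ideal $[\mathcal G,\mathcal G]$ is the direct sum of two ideals (of $[\mathcal G,\mathcal G]$), one isomorphic to a Heisenberg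 Lie algebra $\mathcal H_{2m+1}$ with $m\ge 1$ and the other Abelian (possibly zero). Here $\mathcal H_{2m+1}$ has a basis $e_1,\dots,e_{2m+1}$ whose only nonzero brackets are $[e_j,e_{m+j}]=-[e_{m+j},e_j]=e_{2m+1}$, $1\le j\le m$. -/

import Mathlib

open Bundle
open scoped Manifold ContDiff

noncomputable section

/-- Over `ℝ`, the smoothness `minSmoothness ℝ 3 = 3` is below `∞`; through this instance Mathlib's
Lie bracket on `GroupLieAlgebra` is available on every smooth real Lie group. -/
instance leInfty_minSmoothness_real_three : ENat.LEInfty (minSmoothness ℝ 3) :=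
  ⟨by rw [minSmoothness_of_isRCLikeNormedField]; exact ENat.LEInfty.out⟩

/-! ### Lorentzian bilinear forms -/

/-- A symmetric bilinear form `B` on a real vector space `V` of dimension `n ≥ 2` is Lorentzian if
it has signature `(1, n - 1)`, up to an overall sign: there is a non-isotropic vector `v` such that
`B` is definite, of the sign opposite to that of `B v v`, on the orthogonal complement of `v`. -/
def IsLorentzianForm {V : Type*} [AddCommGroup V] [Module ℝ V] [TopologicalSpace V]
    (B : V →L[ℝ] V →L[ℝ] ℝ) : Prop :=
  2 ≤ Module.finrank ℝ V ∧ (∀ v w, B v w = B w v) ∧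
    ∃ v, B v v ≠ 0 ∧ ∀ w, w ≠ 0 → B v w = 0 → B v v * B w w < 0

/-! ### Pseudo-Riemannian metrics -/

/-- A smooth pseudo-Riemannian metric on a manifold `M` modelled on `E`: a smooth field of
nondegenerate symmetric bilinear forms on the tangent spaces. -/
structure PseudoRiemannianMetric (E : Type*) [NormedAddCommGroup E] [NormedSpace ℝ E]
    (M : Type*) [TopologicalSpace M] [ChartedSpace E M] [IsManifold 𝓘(ℝ, E) ∞ M] where
  /-- The bilinear form on each tangent space. -/
  form (p : M) : TangentSpace 𝓘(ℝ, E) p →L[ℝ] TangentSpace 𝓘(ℝ, E) p →L[ℝ] ℝ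
  symm (p : M) (v w : TangentSpace 𝓘(ℝ, E) p) : form p v w = form p w v
  nondegenerate (p : M) (v : TangentSpace 𝓘(ℝ, E) p) (hv : ∀ w, form p v w = 0) : v = 0
  contMDiff : ContMDiff 𝓘(ℝ, E) (𝓘(ℝ, E).prod 𝓘(ℝ, E →L[ℝ] E →L[ℝ] ℝ)) ∞
    (fun p ↦ TotalSpace.mk' (E →L[ℝ] E →L[ℝ] ℝ) p (form p))

/-- A pseudo-Riemannian metric is Lorentzian if it is so on every tangent space. -/
def PseudoRiemannianMetric.IsLorentzian {E : Type*} [NormedAddCommGroup E] [NormedSpace ℝ E]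
    {M : Type*} [TopologicalSpace M] [ChartedSpace E M] [IsManifold 𝓘(ℝ, E) ∞ M]
    (μ : PseudoRiemannianMetric E M) : Prop :=
  ∀ p : M, IsLorentzianForm (μ.form p)

/-- `μ` is parallel for the connection `D`, i.e. `Dμ = 0`:
`X · μ(Y, Z) = μ(D_X Y, Z) + μ(Y, D_X Z)` at each point `p`, for each tangent vector `X` at `p` and
all vector fields `Y`, `Z` that are differentiable at `p`. -/
def PseudoRiemannianMetric.IsParallel {E : Type*} [NormedAddCommGroup E] [NormedSpace ℝ E]
    {M : Type*} [TopologicalSpace M] [ChartedSpace E M] [IsManifold 𝓘(ℝ, E) ∞ M]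
    (μ : PseudoRiemannianMetric E M)
    (D : CovariantDerivative 𝓘(ℝ, E) E (TangentSpace 𝓘(ℝ, E) : M → Type _)) : Prop :=
  ∀ (p : M) (X : TangentSpace 𝓘(ℝ, E) p) (Y Z : Π q : M, TangentSpace 𝓘(ℝ, E) q),
    MDiffAt (T% Y) p → MDiffAt (T% Z) p →
      mvfderiv 𝓘(ℝ, E) (fun q : M ↦ μ.form q (Y q) (Z q)) p X
        = μ.form p (D Y p X) (Z p) + μ.form p (Y p) (D Z p X)

/-! ### The canonical Cartan-Schouten connection and Cartan-Schouten metrics -/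

section LieGroup

variable {E : Type*} [NormedAddCommGroup E] [NormedSpace ℝ E] [FiniteDimensional ℝ E]
  {G : Type*} [TopologicalSpace G] [ChartedSpace E G] [Group G] [LieGroup 𝓘(ℝ, E) ∞ G]

/-- `D` is the canonical Cartan-Schouten connection of `G`, i.e. `D_{x⁺} y⁺ = ½ [x, y]⁺` for all
`x`, `y` in the Lie algebra, where `x⁺` is the left invariant vector field with value `x` at the
unit. As these fields form a global frame, `D` is determined by this on differentiable vector
fields. -/
def IsCartanSchoutenConnection
    (D : CovariantDerivative 𝓘(ℝ, E) E (TangentSpace 𝓘(ℝ, E) : G → Type _)) : Prop :=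
  ∀ (x y : GroupLieAlgebra 𝓘(ℝ, E) G) (g : G),
    D (mulInvariantVectorField y) g (mulInvariantVectorField x g)
      = (1 / 2 : ℝ) • mulInvariantVectorField ⁅x, y⁆ g

/-- A Cartan-Schouten metric on a Lie group is a pseudo-Riemannian metric which is parallel for the
canonical Cartan-Schouten connection. -/
def IsCartanSchoutenMetric (μ : PseudoRiemannianMetric E G) : Prop :=
  ∃ D : CovariantDerivative 𝓘(ℝ, E) E (TangentSpace 𝓘(ℝ, E) : G → Type _),
    IsCartanSchoutenConnection D ∧ μ.IsParallel D

end LieGroup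

/-! ### Lie algebras -/

/-- A Lie algebra is nondecomposable if it is not the direct sum of two nonzero ideals. -/
def IsNondecomposable (L : Type*) [LieRing L] [LieAlgebra ℝ L] : Prop :=
  ∀ I J : LieIdeal ℝ L, IsCompl I J → I = ⊥ ∨ J = ⊥

/-- The underlying space `ℝᵐ × ℝᵐ × ℝ` of the Heisenberg Lie algebra of dimension `2m + 1`. -/
@[ext]
structure HeisenbergAlgebra (m : ℕ) where
  /-- First block of coordinates. -/
  x : Fin m → ℝ
  /-- Second block of coordinates. -/
  y : Fin m → ℝ
  /-- Central coordinate. -/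
  z : ℝ

namespace HeisenbergAlgebra

variable {m : ℕ}

/-- The coordinates, as a bijection; it transports the vector space structure. -/
def equivProd (m : ℕ) : HeisenbergAlgebra m ≃ (Fin m → ℝ) × (Fin m → ℝ) × ℝ where
  toFun a := (a.x, a.y, a.z)
  invFun p := ⟨p.1, p.2.1, p.2.2⟩
  left_inv _ := rfl
  right_inv _ := rfl

instance : AddCommGroup (HeisenbergAlgebra m) := (equivProd m).addCommGroup

instance : Module ℝ (HeisenbergAlgebra m) := (equivProd m).module ℝ

/-- The bracket `[(x, y, z), (x', y', z')] = (0, 0, x ⬝ y' - x' ⬝ y)`: in the standard basis, the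
only nonzero brackets are `[e_j, e_{m+j}] = e_{2m+1} = -[e_{m+j}, e_j]`. -/
instance : Bracket (HeisenbergAlgebra m) (HeisenbergAlgebra m) where
  bracket a b := ⟨0, 0, a.x ⬝ᵥ b.y - b.x ⬝ᵥ a.y⟩

@[simp] lemma add_x (a b : HeisenbergAlgebra m) : (a + b).x = a.x + b.x := rfl
@[simp] lemma add_y (a b : HeisenbergAlgebra m) : (a + b).y = a.y + b.y := rfl
@[simp] lemma add_z (a b : HeisenbergAlgebra m) : (a + b).z = a.z + b.z := rfl
@[simp] lemma zero_x : (0 : HeisenbergAlgebra m).x = 0 := rfl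
@[simp] lemma zero_y : (0 : HeisenbergAlgebra m).y = 0 := rfl
@[simp] lemma zero_z : (0 : HeisenbergAlgebra m).z = 0 := rfl
@[simp] lemma smul_x (c : ℝ) (a : HeisenbergAlgebra m) : (c • a).x = c • a.x := rfl
@[simp] lemma smul_y (c : ℝ) (a : HeisenbergAlgebra m) : (c • a).y = c • a.y := rfl
@[simp] lemma smul_z (c : ℝ) (a : HeisenbergAlgebra m) : (c • a).z = c * a.z := rfl
@[simp] lemma lie_x (a b : HeisenbergAlgebra m) : ⁅a, b⁆.x = 0 := rfl
@[simp] lemma lie_y (a b : HeisenbergAlgebra m) : ⁅a, b⁆.y = 0 := rfl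
@[simp] lemma lie_z (a b : HeisenbergAlgebra m) : ⁅a, b⁆.z = a.x ⬝ᵥ b.y - b.x ⬝ᵥ a.y := rfl

instance : LieRing (HeisenbergAlgebra m) where
  add_lie a b c := by
    ext <;> simp [add_dotProduct, dotProduct_add]; ring
  lie_add a b c := by
    ext <;> simp [add_dotProduct, dotProduct_add]; ring
  lie_self a := by ext <;> simp
  leibniz_lie a b c := by ext <;> simp

instance : LieAlgebra ℝ (HeisenbergAlgebra m) where
  lie_smul c a b := by
    ext <;> simp [smul_dotProduct, dotProduct_smul]; ring

end HeisenbergAlgebra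

/-- `L` is the direct sum of two ideals, one isomorphic to a Heisenberg Lie algebra (of dimension
`2m + 1` with `m ≥ 1`) and the other Abelian (possibly zero). -/
def IsHeisenbergPlusAbelian (L : Type*) [LieRing L] [LieAlgebra ℝ L] : Prop :=
  ∃ m : ℕ, 1 ≤ m ∧ ∃ I J : LieIdeal ℝ L, IsCompl I J ∧
    Nonempty (I ≃ₗ⁅ℝ⁆ HeisenbergAlgebra m) ∧ IsLieAbelian J

end

/-! ### Lie brackets of vector fields as commutators of derivations -/

section ManifoldCalculus

open VectorField Set Topology

variable {E : Type*} [NormedAddCommGroup E] [NormedSpace ℝ E]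
  {M : Type*} [TopologicalSpace M] [ChartedSpace E M]

/-! In a left invariant frame, `∇μ = 0` prescribes the first derivatives of the coefficients of `μ`.
Differentiating a coefficient along `[x, y]`, directly and as a commutator, shows that every `ad [x,
y]` is skew for the form `B` at the unit (`form_lie_lie`). The rest is algebra.

Let `D = [L, L]`. By Lie's theorem `D` acts nilpotently on `L`. If `D` is central, the nilpotency
class is 2. Otherwise Engel's theorem gives `e ≠ 0` in `[D, L]` killed by `D`, and skewness makes
`e` isotropic. In Lorentzian signature the isotropic vectors of `e⊥` are multiples of `e`, so each
skew nilpotent `ad z`, `z ∈ D`, maps `e⊥` into `ℝe`. It follows that `D ⊆ e⊥`, hence `[D, D] ⊆ ℝe`;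
and `[D, D] ≠ 0`, since otherwise `D` would be central (`exists_derived_of_skew_of_not_central`).
The bracket of `D` is thus an alternating form times `e`; a symplectic basis modulo its radical
splits `D` into a Heisenberg and an Abelian ideal (`isHeisenbergPlusAbelian_of_lie_eq_smul`). -/

lemma fderiv_comp_extChartAt_symm_apply_mpullbackWithin [IsManifold 𝓘(ℝ, E) 1 M]
    {p : M} {y : E} (hy : y ∈ (extChartAt 𝓘(ℝ, E) p).target) {g : M → ℝ}
    (hg : MDiffAt g ((extChartAt 𝓘(ℝ, E) p).symm y))
    (V : Π q : M, TangentSpace 𝓘(ℝ, E) q) :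
    fderiv ℝ (g ∘ (extChartAt 𝓘(ℝ, E) p).symm) y
        (mpullbackWithin 𝓘(ℝ, E) 𝓘(ℝ, E) (extChartAt 𝓘(ℝ, E) p).symm V univ y) =
      mvfderiv 𝓘(ℝ, E) g ((extChartAt 𝓘(ℝ, E) p).symm y)
        (V ((extChartAt 𝓘(ℝ, E) p).symm y)) := by
  have h1 := mdifferentiableWithinAt_extChartAt_symm (I := 𝓘(ℝ, E)) hy
  have h2 := isInvertible_mfderivWithin_extChartAt_symm (I := 𝓘(ℝ, E)) hy
  simp only [modelWithCornersSelf_coe, range_id] at h1 h2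
  rw [← mfderiv_eq_fderiv, ← mfderivWithin_univ,
    mfderiv_comp_mfderivWithin y hg h1 (uniqueMDiffWithinAt_univ _)]
  refine congrArg (mfderiv 𝓘(ℝ, E) 𝓘(ℝ, ℝ) g ((extChartAt 𝓘(ℝ, E) p).symm y)) ?_
  rw [mpullbackWithin_apply]
  exact DFunLike.congr_fun h2.self_comp_inverse _

lemma mvfderiv_eq_fderiv_comp_extChartAt_symm [IsManifold 𝓘(ℝ, E) 1 M] {p : M} {g : M → ℝ}
    (hg : MDiffAt g p) (v : TangentSpace 𝓘(ℝ, E) p) :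
    mvfderiv 𝓘(ℝ, E) g p v =
      fderiv ℝ (g ∘ (extChartAt 𝓘(ℝ, E) p).symm) (extChartAt 𝓘(ℝ, E) p p) v := by
  rw [hg.mvfderiv]
  simp only [modelWithCornersSelf_coe, range_id, fderivWithin_univ]
  rfl

lemma mpullbackWithin_extChartAt_symm_apply_self [IsManifold 𝓘(ℝ, E) 1 M] (p : M)
    (V : Π q : M, TangentSpace 𝓘(ℝ, E) q) :
    mpullbackWithin 𝓘(ℝ, E) 𝓘(ℝ, E) (extChartAt 𝓘(ℝ, E) p).symm V univ
      (extChartAt 𝓘(ℝ, E) p p) = V p := by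
  have h := mfderivWithin_extChartAt_symm_inverse_apply (I := 𝓘(ℝ, E)) (x := p) (V p)
  simp only [modelWithCornersSelf_coe, range_id] at h
  rw [mpullbackWithin_apply]
  have e : ∀ q, q = p → (V q : E) = V p := by rintro q rfl; rfl
  refine Eq.trans (congrArg _ (e _ (extChartAt_to_inv p))) h

lemma ContMDiffAt.contDiffAt_comp_extChartAt_symm [IsManifold 𝓘(ℝ, E) 1 M] {p : M} {f : M → ℝ}
    {n : ℕ∞ω} (hf : CMDiffAt n f p) :
    ContDiffAt ℝ n (f ∘ (extChartAt 𝓘(ℝ, E) p).symm) (extChartAt 𝓘(ℝ, E) p p) := by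
  have h := (contMDiffAt_iff.1 hf).2
  simp only [modelWithCornersSelf_coe, range_id, contDiffWithinAt_univ] at h
  exact h

lemma MDifferentiableAt.differentiableAt_mpullbackWithin_extChartAt_symm
    [IsManifold 𝓘(ℝ, E) 2 M] [CompleteSpace E] {V : Π q : M, TangentSpace 𝓘(ℝ, E) q} {p : M}
    (hV : MDiffAt (T% V) p) :
    DifferentiableAt ℝ (F := E)
      (mpullbackWithin 𝓘(ℝ, E) 𝓘(ℝ, E) (extChartAt 𝓘(ℝ, E) p).symm V univ)
      (extChartAt 𝓘(ℝ, E) p p) := by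
  have h := hV.mdifferentiableWithinAt (s := univ)
    |>.differentiableWithinAt_mpullbackWithin_vectorField
  simp only [modelWithCornersSelf_coe, range_id, preimage_univ, inter_self] at h
  exact differentiableWithinAt_univ.1 h

lemma mvfderiv_mvfderiv_apply [IsManifold 𝓘(ℝ, E) 2 M] [CompleteSpace E]
    {f : M → ℝ} (hf : CMDiff 2 f) {X Y : Π q : M, TangentSpace 𝓘(ℝ, E) q} {p : M}
    (hY : MDiffAt (T% Y) p) :
    mvfderiv 𝓘(ℝ, E) (fun q ↦ mvfderiv 𝓘(ℝ, E) f q (Y q)) p (X p) =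
      fderiv ℝ (fun y ↦ fderiv ℝ (f ∘ (extChartAt 𝓘(ℝ, E) p).symm) y
        (mpullbackWithin 𝓘(ℝ, E) 𝓘(ℝ, E) (extChartAt 𝓘(ℝ, E) p).symm Y univ y))
        (extChartAt 𝓘(ℝ, E) p p)
        (mpullbackWithin 𝓘(ℝ, E) 𝓘(ℝ, E) (extChartAt 𝓘(ℝ, E) p).symm X univ
          (extChartAt 𝓘(ℝ, E) p p)) := by
  have : IsManifold 𝓘(ℝ, E) 1 M := .of_le (n := 2) (by norm_num)
  have hfd : MDifferentiable 𝓘(ℝ, E) 𝓘(ℝ, ℝ) f := hf.mdifferentiable (by norm_num)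
  have hev : (fun q ↦ mvfderiv 𝓘(ℝ, E) f q (Y q)) ∘ (extChartAt 𝓘(ℝ, E) p).symm
      =ᶠ[𝓝 (extChartAt 𝓘(ℝ, E) p p)] fun y ↦ fderiv ℝ (f ∘ (extChartAt 𝓘(ℝ, E) p).symm) y
        (mpullbackWithin 𝓘(ℝ, E) 𝓘(ℝ, E) (extChartAt 𝓘(ℝ, E) p).symm Y univ y) := by
    filter_upwards [extChartAt_target_mem_nhds (I := 𝓘(ℝ, E)) p] with y hy
    exact (fderiv_comp_extChartAt_symm_apply_mpullbackWithin hy (hfd _) Y).symm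
  have hd : DifferentiableAt ℝ (fun y ↦ fderiv ℝ (f ∘ (extChartAt 𝓘(ℝ, E) p).symm) y
        (mpullbackWithin 𝓘(ℝ, E) 𝓘(ℝ, E) (extChartAt 𝓘(ℝ, E) p).symm Y univ y))
        (extChartAt 𝓘(ℝ, E) p p) :=
    (((hf p).contDiffAt_comp_extChartAt_symm.fderiv_right (m := 1) (by norm_num)).differentiableAt
      (by norm_num)).clm_apply
      hY.differentiableAt_mpullbackWithin_extChartAt_symm
  have hmd : MDiffAt (fun q ↦ mvfderiv 𝓘(ℝ, E) f q (Y q)) p := by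
    rw [← mdifferentiableWithinAt_univ]
    refine DifferentiableWithinAt.mdifferentiableWithinAt_of_comp_extChartAt_symm ?_
    simpa [differentiableWithinAt_univ, -extChartAt] using
      (hev.differentiableAt_iff.2 hd).differentiableWithinAt (s := univ)
  rw [mvfderiv_eq_fderiv_comp_extChartAt_symm hmd, hev.fderiv_eq,
    mpullbackWithin_extChartAt_symm_apply_self]

/-- The differentiation operator along a Lie bracket of vector fields is the commutator of the
differentiation operators. -/
lemma mvfderiv_mlieBracket [IsManifold 𝓘(ℝ, E) 2 M] [CompleteSpace E]
    {f : M → ℝ} (hf : CMDiff 2 f) {X Y : Π q : M, TangentSpace 𝓘(ℝ, E) q} {p : M}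
    (hX : MDiffAt (T% X) p) (hY : MDiffAt (T% Y) p) :
    mvfderiv 𝓘(ℝ, E) f p (mlieBracket 𝓘(ℝ, E) X Y p) =
      mvfderiv 𝓘(ℝ, E) (fun q ↦ mvfderiv 𝓘(ℝ, E) f q (Y q)) p (X p) -
        mvfderiv 𝓘(ℝ, E) (fun q ↦ mvfderiv 𝓘(ℝ, E) f q (X q)) p (Y p) := by
  have : IsManifold 𝓘(ℝ, E) 1 M := .of_le (n := 2) (by norm_num)
  have hfd : MDifferentiable 𝓘(ℝ, E) 𝓘(ℝ, ℝ) f := hf.mdifferentiable (by norm_num)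
  rw [mvfderiv_mvfderiv_apply hf hX, mvfderiv_mvfderiv_apply hf hY,
    ← mlieBracketWithin_univ, mlieBracketWithin_apply]
  simp only [modelWithCornersSelf_coe, range_id, preimage_univ, inter_self]
  rw [← fderiv_apply_lieBracket (hf p).contDiffAt_comp_extChartAt_symm (by simp)
    hY.differentiableAt_mpullbackWithin_extChartAt_symm
    hX.differentiableAt_mpullbackWithin_extChartAt_symm, mvfderiv_eq_fderiv_comp_extChartAt_symm
    (hfd p)]
  -- The derivative of the chart centred at `p` is the identity at `p`, so the pullback in the
  -- definition of the bracket is invisible there.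
  have e (w : E) : (mfderiv 𝓘(ℝ, E) 𝓘(ℝ, E) (extChartAt 𝓘(ℝ, E) p) p).inverse w = w :=
    (congrArg (fun A : E →L[ℝ] E ↦ A.inverse w) mfderiv_extChartAt_self).trans
      (congrArg (fun B : E →L[ℝ] E ↦ B w) (ContinuousLinearMap.inverse_id (R := ℝ) (M := E)))
  refine congrArg _ ((e _).trans ?_)
  exact congrFun (lieBracketWithin_univ (𝕜 := ℝ) (E := E)) _

end ManifoldCalculus

/-! ### Skewness of `ad [x, y]` for a Cartan-Schouten metric -/

section CartanSchouten

variable {E : Type*} [NormedAddCommGroup E] [NormedSpace ℝ E] [FiniteDimensional ℝ E]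
  {G : Type*} [TopologicalSpace G] [ChartedSpace E G] [Group G] [LieGroup 𝓘(ℝ, E) ∞ G]

omit [FiniteDimensional ℝ E] [Group G] [LieGroup 𝓘(ℝ, E) ∞ G] in
lemma mvfderiv_const_mul_add (c : ℝ) {F H : G → ℝ} {p : G} (hF : MDiffAt F p) (hH : MDiffAt H p)
    (v : TangentSpace 𝓘(ℝ, E) p) :
    mvfderiv 𝓘(ℝ, E) (fun q ↦ c * (F q + H q)) p v =
      c * (mvfderiv 𝓘(ℝ, E) F p v + mvfderiv 𝓘(ℝ, E) H p v) := by
  have h := mvfderiv_mul (f := fun _ : G ↦ c) (g := F + H) (x := p) mdifferentiableAt_const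
    (hF.add hH)
  rw [mvfderiv_const, mvfderiv_add hF hH] at h
  exact (DFunLike.congr_fun h v).trans (by simp [mul_add])

omit [FiniteDimensional ℝ E] in
lemma contMDiff_form_mulInvariantVectorField (μ : PseudoRiemannianMetric E G)
    (y z : GroupLieAlgebra 𝓘(ℝ, E) G) :
    CMDiff 2 (fun g : G ↦ μ.form g (mulInvariantVectorField y g) (mulInvariantVectorField z g)) := by
  have hm : (2 : ℕ∞ω) ≤ minSmoothness ℝ 2 := le_minSmoothness
  have hy := (contMDiff_mulInvariantVectorField (I := 𝓘(ℝ, E)) (G := G) y).of_le hm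
  have hz := (contMDiff_mulInvariantVectorField (I := 𝓘(ℝ, E)) (G := G) z).of_le hm
  intro g
  have h : ContMDiffAt 𝓘(ℝ, E) (𝓘(ℝ, E).prod 𝓘(ℝ)) 2
      (fun g ↦ TotalSpace.mk' ℝ (E := Bundle.Trivial G ℝ) g
        (μ.form g (mulInvariantVectorField y g) (mulInvariantVectorField z g))) g := by
    apply ContMDiffAt.clm_bundle_apply₂ (F₁ := E) (F₂ := E)
    · exact (μ.contMDiff.of_le ENat.LEInfty.out) g
    · exact hy g
    · exact hz g
  simp only [contMDiffAt_totalSpace] at h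
  exact h.2

omit [FiniteDimensional ℝ E] in
/-- The derivatives of the coefficients of a Cartan-Schouten metric in a left invariant frame. -/
lemma IsCartanSchoutenMetric.mvfderiv_form {μ : PseudoRiemannianMetric E G}
    (hμ : IsCartanSchoutenMetric μ) (x y z : GroupLieAlgebra 𝓘(ℝ, E) G) (g : G) :
    mvfderiv 𝓘(ℝ, E)
        (fun g : G ↦ μ.form g (mulInvariantVectorField y g) (mulInvariantVectorField z g)) g
        (mulInvariantVectorField x g) =
      (1 / 2 : ℝ) * (μ.form g (mulInvariantVectorField ⁅x, y⁆ g) (mulInvariantVectorField z g) +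
        μ.form g (mulInvariantVectorField y g) (mulInvariantVectorField ⁅x, z⁆ g)) := by
  obtain ⟨D, hD, hp⟩ := hμ
  rw [hp g _ _ _ (mdifferentiableAt_mulInvariantVectorField y)
    (mdifferentiableAt_mulInvariantVectorField z), hD, hD]
  simp
  ring

/-- The operators `ad [x, y]` are skew-symmetric for a Cartan-Schouten metric. -/
theorem IsCartanSchoutenMetric.form_lie_lie {μ : PseudoRiemannianMetric E G}
    (hμ : IsCartanSchoutenMetric μ) (x y z w : GroupLieAlgebra 𝓘(ℝ, E) G) :
    μ.form 1 ⁅⁅x, y⁆, z⁆ w = - μ.form 1 z ⁅⁅x, y⁆, w⁆ := by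
  have : IsManifold 𝓘(ℝ, E) 2 G := .of_le (n := ∞) ENat.LEInfty.out
  have h1 (x : GroupLieAlgebra 𝓘(ℝ, E) G) : mulInvariantVectorField x (1 : G) = x := by
    have h : HasMFDerivAt 𝓘(ℝ, E) 𝓘(ℝ, E) (fun h : G ↦ 1 * h) 1
        (ContinuousLinearMap.id ℝ (TangentSpace 𝓘(ℝ, E) (1 : G))) :=
      (hasMFDerivAt_id (I := 𝓘(ℝ, E)) (1 : G)).congr_of_eventuallyEq (.of_forall one_mul)
    exact DFunLike.congr_fun h.mfderiv x
  have key := mvfderiv_mlieBracket (contMDiff_form_mulInvariantVectorField μ z w)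
    (mdifferentiableAt_mulInvariantVectorField x (g := 1))
    (mdifferentiableAt_mulInvariantVectorField y (g := 1))
  rw [← mulInvariantVector_mlieBracket, ← GroupLieAlgebra.bracket_def] at key
  have hd (y z : GroupLieAlgebra 𝓘(ℝ, E) G) :=
    (contMDiff_form_mulInvariantVectorField μ y z).mdifferentiable (by norm_num) 1
  have e (a b : GroupLieAlgebra 𝓘(ℝ, E) G) :
      mvfderiv 𝓘(ℝ, E) (fun g : G ↦ mvfderiv 𝓘(ℝ, E)
        (fun g : G ↦ μ.form g (mulInvariantVectorField z g) (mulInvariantVectorField w g)) g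
        (mulInvariantVectorField b g)) 1 (mulInvariantVectorField a 1) =
      (1 / 4 : ℝ) * (μ.form 1 ⁅a, ⁅b, z⁆⁆ w + μ.form 1 ⁅b, z⁆ ⁅a, w⁆ + μ.form 1 ⁅a, z⁆ ⁅b, w⁆ +
        μ.form 1 z ⁅a, ⁅b, w⁆⁆) := by
    simp only [hμ.mvfderiv_form]
    rw [mvfderiv_const_mul_add _ (hd _ _) (hd _ _), hμ.mvfderiv_form, hμ.mvfderiv_form]
    simp only [h1]
    ring
  rw [hμ.mvfderiv_form, e, e] at key
  simp only [h1] at key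
  have l1 := lie_lie x y z
  have l2 := lie_lie x y w
  -- The mixed terms of the two second derivatives cancel. With `S = B([[x, y], z], w) + B(z, [[x,
  -- y], w])`, `key` reads `S / 2 = S / 4`, so `S = 0`.
  rw [l1, l2] at key ⊢
  simp only [map_sub, sub_apply] at key ⊢
  linarith

end CartanSchouten

/-! ### Nilpotent action of the derived ideal -/

section LieTheorem

open LieModule TensorProduct

/-- The derived ideal of a solvable Lie algebra acts nilpotently on every finite-dimensional
module. -/
theorem isNilpotent_toEnd_of_mem_derived_of_isAlgClosed {K L : Type*} [Field K] [CharZero K]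
    [IsAlgClosed K] [LieRing L] [LieAlgebra K L] [LieAlgebra.IsSolvable L]
    (V : Type*) [AddCommGroup V] [Module K V] [LieRingModule L V] [LieModule K L V]
    [Module.Finite K V] {z : L} (hz : z ∈ ⁅(⊤ : LieIdeal K L), (⊤ : LieIdeal K L)⁆) :
    IsNilpotent (toEnd K L V z) := by
  induction hn : Module.finrank K V using Nat.strong_induction_on generalizing V with
  | _ n ih =>
  subst hn
  rcases subsingleton_or_nontrivial V with hV | hV
  · exact ⟨1, LinearMap.ext fun _ ↦ Subsingleton.elim _ _⟩
  obtain ⟨χ, hχ⟩ := exists_nontrivial_weightSpace_of_isSolvable K L V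
  -- On a common eigenvector the algebra acts by scalars, which commute, so `χ` vanishes on
  -- brackets.
  have hχz : χ z = 0 := by
    obtain ⟨⟨v, hv⟩, hv0⟩ := exists_ne (0 : weightSpace V χ)
    rw [mem_weightSpace] at hv
    have hv0 : v ≠ 0 := by simpa using hv0
    clear ih
    rw [← LieSubmodule.mem_toSubmodule, LieSubmodule.lieIdeal_oper_eq_linear_span'] at hz
    induction hz using Submodule.span_induction with
    | mem _ h =>
      obtain ⟨x, -, y, -, rfl⟩ := h
      have h := hv ⁅x, y⁆
      rw [lie_lie, hv y, hv x, lie_smul, lie_smul, hv, hv, smul_comm, sub_self] at h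
      exact (smul_eq_zero.1 h.symm).resolve_right hv0
    | zero => simp
    | add a b _ _ ha hb => rw [map_add, ha, hb, add_zero]
    | smul c a _ ha => rw [map_smul, ha, smul_zero]
  have hlt : Module.finrank K (V ⧸ weightSpace V χ) < Module.finrank K V := by
    have h1 : 0 < Module.finrank K (weightSpace V χ) := Module.finrank_pos
    have h2 := Submodule.finrank_quotient_add_finrank (weightSpace V χ).toSubmodule
    have h3 : Module.finrank K (V ⧸ weightSpace V χ) =
      Module.finrank K (V ⧸ (weightSpace V χ).toSubmodule) := rfl
    have h4 : Module.finrank K (weightSpace V χ) =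
      Module.finrank K (weightSpace V χ).toSubmodule := rfl
    omega
  obtain ⟨k, hk⟩ := ih _ hlt (V ⧸ weightSpace V χ) rfl
  have hmk (j : ℕ) (v : V) : LieSubmodule.Quotient.mk' (weightSpace V χ) ((toEnd K L V z ^ j) v) =
      (toEnd K L (V ⧸ weightSpace V χ) z ^ j) (LieSubmodule.Quotient.mk' (weightSpace V χ) v) := by
    induction j generalizing v with
    | zero => simp
    | succ j ihj =>
      rw [pow_succ, Module.End.mul_apply, ihj, pow_succ, Module.End.mul_apply]
      simp
  -- The `k`-th power of `z` kills the quotient, so it lands in the weight space, which `z`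
  -- annihilates.
  refine ⟨k + 1, LinearMap.ext fun v ↦ ?_⟩
  have hv : (toEnd K L V z ^ k) v ∈ weightSpace V χ := by
    have := hmk k v
    rw [hk, LinearMap.zero_apply] at this
    rwa [LieSubmodule.Quotient.mk_eq_zero] at this
  rw [pow_succ', Module.End.mul_apply, toEnd_apply_apply, (mem_weightSpace _ _).1 hv, hχz,
    zero_smul, LinearMap.zero_apply]

/-- Common eigenvectors need an algebraically closed field: pass to `ℂ ⊗ L` and return through the
injection `w ↦ 1 ⊗ w`. -/
theorem LieAlgebra.isNilpotent_ad_of_mem_derived {L : Type*} [LieRing L] [LieAlgebra ℝ L]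
    [FiniteDimensional ℝ L] [LieAlgebra.IsSolvable L] {z : L}
    (hz : z ∈ ⁅(⊤ : LieIdeal ℝ L), (⊤ : LieIdeal ℝ L)⁆) :
    IsNilpotent (LieAlgebra.ad ℝ L z) := by
  have hz' : (1 : ℂ) ⊗ₜ[ℝ] z ∈
      ⁅(⊤ : LieIdeal ℂ (ℂ ⊗[ℝ] L)), (⊤ : LieIdeal ℂ (ℂ ⊗[ℝ] L))⁆ := by
    have h := LieSubmodule.tmul_mem_baseChange_of_mem (1 : ℂ) hz
    rwa [LieSubmodule.lie_baseChange, LieSubmodule.baseChange_top] at h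
  obtain ⟨k, hk⟩ := isNilpotent_toEnd_of_mem_derived_of_isAlgClosed (ℂ ⊗[ℝ] L) hz'
  refine ⟨k, LinearMap.ext fun w ↦ ?_⟩
  have hpow (j : ℕ) : (toEnd ℂ (ℂ ⊗[ℝ] L) (ℂ ⊗[ℝ] L) (1 ⊗ₜ[ℝ] z) ^ j) (1 ⊗ₜ[ℝ] w) =
      1 ⊗ₜ[ℝ] ((LieAlgebra.ad ℝ L z ^ j) w) := by
    induction j with
    | zero => simp
    | succ j ihj =>
      rw [pow_succ', Module.End.mul_apply, ihj, pow_succ', Module.End.mul_apply, toEnd_apply_apply,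
        LieAlgebra.ExtendScalars.bracket_tmul, one_mul, LieAlgebra.ad_apply]
  have h := hpow k
  rw [hk, LinearMap.zero_apply] at h
  have hinj := Module.FaithfullyFlat.tensorProduct_mk_injective (A := ℝ) (B := ℂ) L
  exact hinj (by simpa using h.symm)

end LieTheorem

/-! ### Isotropic vectors in Lorentzian signature -/

section LorentzianForms

variable {V : Type*} [AddCommGroup V] [Module ℝ V]

/-- In a Lorentzian space, an isotropic vector orthogonal to a nonzero isotropic vector is a
multiple of it. -/
lemma exists_eq_smul_of_isotropic (B : LinearMap.BilinForm ℝ V) (hsymm : ∀ v w, B v w = B w v)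
    (hLor : ∃ v, B v v ≠ 0 ∧ ∀ w, w ≠ 0 → B v w = 0 → B v v * B w w < 0)
    {e w : V} (he : e ≠ 0) (hee : B e e = 0) (hew : B e w = 0) (hww : B w w = 0) :
    ∃ c : ℝ, w = c • e := by
  obtain ⟨v, -, hv⟩ := hLor
  have hve : B v e ≠ 0 := fun h ↦ by simpa [hee] using hv e he h
  -- This coefficient makes `w - c • e` orthogonal to `v`, where `B` is definite; the difference is
  -- also isotropic, so it vanishes.
  refine ⟨B v w / B v e, ?_⟩
  by_contra hne
  have h := hv (w - (B v w / B v e) • e) (sub_ne_zero.2 hne) (by simp [hve])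
  simp [hee, hew, hww, hsymm w e] at h

end LorentzianForms

/-! ### Skew nilpotent actions on a Lorentzian space -/

namespace LieAlgebra

open LieModule

variable {L : Type*} [LieRing L] [LieAlgebra ℝ L]

/-- If the derived algebra of a solvable Lie algebra acts by skew-symmetric operators and is not
central, it annihilates a nonzero isotropic vector orthogonal to its image. -/
lemma exists_isotropic_of_skew [FiniteDimensional ℝ L] [IsSolvable L]
    {B : LinearMap.BilinForm ℝ L}
    (hskew : ∀ z ∈ ⁅(⊤ : LieIdeal ℝ L), (⊤ : LieIdeal ℝ L)⁆, ∀ a b, B ⁅z, a⁆ b = -B a ⁅z, b⁆)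
    (hc : ∃ z ∈ ⁅(⊤ : LieIdeal ℝ L), (⊤ : LieIdeal ℝ L)⁆, ∃ w : L, ⁅z, w⁆ ≠ 0) :
    ∃ e : L, e ≠ 0 ∧ B e e = 0 ∧
      ∀ z ∈ ⁅(⊤ : LieIdeal ℝ L), (⊤ : LieIdeal ℝ L)⁆, ⁅z, e⁆ = 0 := by
  set D : LieIdeal ℝ L := ⁅(⊤ : LieIdeal ℝ L), (⊤ : LieIdeal ℝ L)⁆
  have hnil : LieModule.IsNilpotent D L :=
    -- Engel's theorem.
    isNilpotent_iff_forall' (R := ℝ) |>.2 fun z ↦ isNilpotent_ad_of_mem_derived z.2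
  let I : LieSubmodule ℝ D L := ⁅(⊤ : LieIdeal ℝ D), (⊤ : LieSubmodule ℝ D L)⁆
  have hI : Nontrivial I := by
    obtain ⟨z, hz, w, hzw⟩ := hc
    refine ⟨⟨⟨⁅z, w⁆, ?_⟩, 0, fun h ↦ hzw (congrArg Subtype.val h)⟩⟩
    exact LieSubmodule.lie_mem_lie (x := (⟨z, hz⟩ : D)) (LieSubmodule.mem_top _)
      (LieSubmodule.mem_top w)
  have : LieModule.IsNilpotent D I :=
    Function.Injective.lieModuleIsNilpotent (R := ℝ) (f := (LieHom.id : D →ₗ⁅ℝ⁆ D))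
      (g := I.toSubmodule.subtype) (fun _ _ ↦ rfl) Subtype.val_injective
  obtain ⟨⟨⟨e, heI⟩, heT⟩, hne⟩ := @exists_ne _ (nontrivial_max_triv_of_isNilpotent ℝ D I) 0
  have hze : ∀ z ∈ D, ⁅z, e⁆ = 0 := fun z hz ↦ congrArg Subtype.val (heT ⟨z, hz⟩)
  refine ⟨e, fun h ↦ hne (Subtype.ext (Subtype.ext h)), ?_, hze⟩
  -- By skewness the image `I` is orthogonal to whatever `D` kills; `e` lies in both.
  have h (u : L) (hu : u ∈ I) : B u e = 0 := by
    rw [← LieSubmodule.mem_toSubmodule, LieSubmodule.lieIdeal_oper_eq_linear_span'] at hu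
    induction hu using Submodule.span_induction with
    | mem _ h =>
      obtain ⟨z, -, w, -, rfl⟩ := h
      exact (hskew z z.2 w e).trans (by rw [hze z z.2]; simp)
    | zero => simp
    | add a b _ _ ha hb => simp [ha, hb]
    | smul c a _ ha => simp [ha]
  exact h e heI

/-- Descent on powers of `A = ad z`: if `A^(i+2) w ∈ ℝe`, then `B(A^(i+1) w, A^(i+1) w) = -B(A^i w,
A^(i+2) w) = 0`, so `A^(i+1) w`, isotropic and orthogonal to `e`, is also in `ℝe`. Nilpotency starts
the descent. -/
lemma exists_lie_eq_smul_of_skew_of_isNilpotent {B : LinearMap.BilinForm ℝ L}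
    (hsymm : ∀ v w, B v w = B w v)
    (hLor : ∃ v, B v v ≠ 0 ∧ ∀ w, w ≠ 0 → B v w = 0 → B v v * B w w < 0)
    {e z : L} (he : e ≠ 0) (hee : B e e = 0) (hze : ⁅z, e⁆ = 0)
    (hskew : ∀ a b, B ⁅z, a⁆ b = -B a ⁅z, b⁆) (hnil : _root_.IsNilpotent (ad ℝ L z))
    {w : L} (hew : B e w = 0) : ∃ c : ℝ, ⁅z, w⁆ = c • e := by
  have horth (i : ℕ) : B e ((ad ℝ L z ^ i) w) = 0 := by
    cases i with
    | zero => simpa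
    | succ i =>
      have := hskew e ((ad ℝ L z ^ i) w)
      rw [hze] at this
      simpa [pow_succ'] using this
  have hstep (i : ℕ) (h : ∃ c : ℝ, (ad ℝ L z ^ (i + 2)) w = c • e) :
      ∃ c : ℝ, (ad ℝ L z ^ (i + 1)) w = c • e := by
    obtain ⟨c, hc⟩ := h
    refine exists_eq_smul_of_isotropic B hsymm hLor he hee (horth _) ?_
    have h1 : (ad ℝ L z ^ (i + 1)) w = ⁅z, (ad ℝ L z ^ i) w⁆ := by simp [pow_succ']
    have h2 : (ad ℝ L z ^ (i + 2)) w = ⁅z, (ad ℝ L z ^ (i + 1)) w⁆ := by simp [pow_succ']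
    nth_rw 1 [h1]
    rw [hskew, ← h2, hc, map_smul, hsymm, horth, smul_zero, neg_zero]
  obtain ⟨k, hk⟩ := hnil
  have hdesc (j : ℕ) (h : ∃ c : ℝ, (ad ℝ L z ^ (j + 1)) w = c • e) : ∃ c : ℝ, ⁅z, w⁆ = c • e := by
    induction j with
    | zero => simpa using h
    | succ j ih => exact ih (hstep j h)
  exact hdesc k ⟨0, by simp [pow_succ', hk]⟩

/-- The space is `e⊥ ⊕ ℝz₀`. If `[z, w] = c e` with `w ∈ e⊥`, pairing with `z₀` gives `c B(z₀, e) =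
-B([z, z₀], w) = 0`. -/
lemma lie_eq_zero_of_skew {B : LinearMap.BilinForm ℝ L} {e z z₀ : L}
    (hskew : ∀ a b, B ⁅z, a⁆ b = -B a ⁅z, b⁆)
    (horth : ∀ w, B e w = 0 → ∃ c : ℝ, ⁅z, w⁆ = c • e) (hsymm : ∀ v w, B v w = B w v)
    (hz₀ : B e z₀ ≠ 0) (hzz₀ : ⁅z, z₀⁆ = 0) (w : L) : ⁅z, w⁆ = 0 := by
  have hperp (w : L) (hw : B e w = 0) : ⁅z, w⁆ = 0 := by
    obtain ⟨c, hc⟩ := horth w hw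
    have h := hskew z₀ w
    rw [hzz₀, hc, map_zero, LinearMap.zero_apply, map_smul, hsymm z₀, smul_eq_mul, eq_comm,
      neg_eq_zero] at h
    rw [hc, (mul_eq_zero.1 h).resolve_right hz₀, zero_smul]
  have h := hperp (w - (B e w / B e z₀) • z₀) (by simp [hz₀])
  simpa [hzz₀] using h

/-- Structure of the derived algebra of a solvable Lie algebra, if it acts by operators that are
skew-symmetric for a Lorentzian form and is not central. -/
theorem exists_derived_of_skew_of_not_central [FiniteDimensional ℝ L] [IsSolvable L]
    {B : LinearMap.BilinForm ℝ L} (hsymm : ∀ v w, B v w = B w v)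
    (hnd : ∀ v, (∀ w, B v w = 0) → v = 0)
    (hLor : ∃ v, B v v ≠ 0 ∧ ∀ w, w ≠ 0 → B v w = 0 → B v v * B w w < 0)
    (hskew : ∀ z ∈ ⁅(⊤ : LieIdeal ℝ L), (⊤ : LieIdeal ℝ L)⁆, ∀ a b, B ⁅z, a⁆ b = -B a ⁅z, b⁆)
    (hc : ∃ z ∈ ⁅(⊤ : LieIdeal ℝ L), (⊤ : LieIdeal ℝ L)⁆, ∃ w : L, ⁅z, w⁆ ≠ 0) :
    ∃ e ∈ ⁅(⊤ : LieIdeal ℝ L), (⊤ : LieIdeal ℝ L)⁆, e ≠ 0 ∧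
      (∀ z ∈ ⁅(⊤ : LieIdeal ℝ L), (⊤ : LieIdeal ℝ L)⁆, ⁅z, e⁆ = 0) ∧
      (∀ z ∈ ⁅(⊤ : LieIdeal ℝ L), (⊤ : LieIdeal ℝ L)⁆,
        ∀ w ∈ ⁅(⊤ : LieIdeal ℝ L), (⊤ : LieIdeal ℝ L)⁆, ∃ c : ℝ, ⁅z, w⁆ = c • e) ∧
      ∃ z ∈ ⁅(⊤ : LieIdeal ℝ L), (⊤ : LieIdeal ℝ L)⁆,
        ∃ w ∈ ⁅(⊤ : LieIdeal ℝ L), (⊤ : LieIdeal ℝ L)⁆, ⁅z, w⁆ ≠ 0 := by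
  obtain ⟨e, he, hee, hze⟩ := exists_isotropic_of_skew hskew hc
  set D : LieIdeal ℝ L := ⁅(⊤ : LieIdeal ℝ L), (⊤ : LieIdeal ℝ L)⁆
  have horth : ∀ z ∈ D, ∀ w, B e w = 0 → ∃ c : ℝ, ⁅z, w⁆ = c • e := fun z hz w hw ↦
    exists_lie_eq_smul_of_skew_of_isNilpotent hsymm hLor he hee (hze z hz) (hskew z hz)
      (isNilpotent_ad_of_mem_derived hz) hw
  have hcomp : ∀ z ∈ D, ∀ z₀, B e z₀ ≠ 0 → ⁅z, z₀⁆ = 0 → ∀ w : L, ⁅z, w⁆ = 0 :=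
    fun z hz z₀ h0 h1 w ↦ lie_eq_zero_of_skew (hskew z hz) (horth z hz) hsymm h0 h1 w
  -- An element `z₀` of `D` outside `e⊥` kills itself, hence is central; then all of `D` kills `z₀`,
  -- hence is central.
  have hDe : ∀ z ∈ D, B e z = 0 := by
    by_contra! h
    obtain ⟨z₀, hz₀, h0⟩ := h
    have h1 := hcomp z₀ hz₀ z₀ h0 (lie_self z₀)
    obtain ⟨z, hz, w, hzw⟩ := hc
    exact hzw (hcomp z hz z₀ h0 (by rw [← lie_skew, h1, neg_zero]) w)
  have hDD : ∀ z ∈ D, ∀ w ∈ D, ∃ c : ℝ, ⁅z, w⁆ = c • e :=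
    fun z hz w hw ↦ horth z hz w (hDe w hw)
  -- If `D` were Abelian, `[z, w]` would be isotropic in `e⊥`, so `ad z` would map all of `L` into
  -- `ℝe`; skewness on a vector `w₀` outside `e⊥` then gives `[z, w₀] = 0`, and `z` is central.
  have hne : ∃ z ∈ D, ∃ w ∈ D, ⁅z, w⁆ ≠ 0 := by
    by_contra! h
    obtain ⟨z, hz, w, hzw⟩ := hc
    have hline (w : L) : ∃ c : ℝ, ⁅z, w⁆ = c • e := by
      have hu : ⁅z, w⁆ ∈ D := lie_mem_left ℝ L D z w hz
      refine exists_eq_smul_of_isotropic B hsymm hLor he hee (hDe _ hu) ?_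
      rw [hskew z hz, h z hz _ hu, map_zero, neg_zero]
    obtain ⟨w₀, hw₀⟩ : ∃ w₀, B e w₀ ≠ 0 := by
      by_contra! h
      exact he (hnd e h)
    refine hzw (hcomp z hz w₀ hw₀ ?_ w)
    obtain ⟨c, hcw⟩ := hline w₀
    have h2 := hskew z hz w₀ w₀
    rw [hsymm w₀, hcw] at h2
    simp only [map_smul, LinearMap.smul_apply, smul_eq_mul] at h2
    have h3 : c * B e w₀ = 0 := by linarith
    rw [hcw, (mul_eq_zero.1 h3).resolve_right hw₀, zero_smul]
  refine ⟨e, ?_, he, hze, hDD, hne⟩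
  obtain ⟨z, hz, w, hw, hzw⟩ := hne
  obtain ⟨c, hcw⟩ := hDD z hz w hw
  have hc0 : c ≠ 0 := by
    rintro rfl
    exact hzw (by rw [hcw, zero_smul])
  have h := D.smul_mem c⁻¹ (lie_mem_left ℝ L D z w hz)
  rwa [hcw, smul_smul, inv_mul_cancel₀ hc0, one_smul] at h

end LieAlgebra

/-! ### Symplectic bases of alternating forms -/

section Symplectic

variable {V : Type*} [AddCommGroup V] [Module ℝ V]

/-- A pair of families which spans a symplectic subspace, as a standard symplectic basis. -/
structure IsSymplecticFamily (Ω : LinearMap.BilinForm ℝ V) {m : ℕ} (p q : Fin m → V) : Prop where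
  left (i j) : Ω (p i) (p j) = 0
  right (i j) : Ω (q i) (q j) = 0
  pairing (i j) : Ω (p i) (q j) = if i = j then 1 else 0

variable {Ω : LinearMap.BilinForm ℝ V} {m : ℕ} {p q : Fin m → V}

lemma IsSymplecticFamily.apply_sum_right (h : IsSymplecticFamily Ω p q)
    (x y : Fin m → ℝ) (j : Fin m) :
    Ω (∑ i, x i • p i + ∑ i, y i • q i) (q j) = x j := by
  simp [h.right, h.pairing]

lemma IsSymplecticFamily.apply_left_sum (h : IsSymplecticFamily Ω p q)
    (x y : Fin m → ℝ) (j : Fin m) :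
    Ω (p j) (∑ i, x i • p i + ∑ i, y i • q i) = y j := by
  simp [h.left, h.pairing]

lemma IsSymplecticFamily.le_finrank [FiniteDimensional ℝ V] (h : IsSymplecticFamily Ω p q) :
    m ≤ Module.finrank ℝ V := by
  have : LinearIndependent ℝ p := by
    rw [Fintype.linearIndependent_iff]
    intro x hx j
    have := h.apply_sum_right x 0 j
    simpa [hx] using this.symm
  simpa using this.fintype_card_le_finrank

lemma IsSymplecticFamily.cons (h : IsSymplecticFamily Ω p q) (hΩ : Ω.IsAlt) {u v : V}
    (hpu : ∀ i, Ω (p i) u = 0) (huq : ∀ i, Ω u (q i) = 0)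
    (hpv : ∀ i, Ω (p i) v = 0) (hvq : ∀ i, Ω v (q i) = 0) (huv : Ω u v = 1) :
    IsSymplecticFamily Ω (Fin.cons u p : Fin (m + 1) → V) (Fin.cons v q : Fin (m + 1) → V) where
  left i j := by
    have hup (i) : Ω u (p i) = 0 := by rw [← hΩ.neg_eq, hpu, neg_zero]
    cases i using Fin.cases <;> cases j using Fin.cases <;> simp [h.left, hΩ.self_eq_zero, hpu, hup]
  right i j := by
    have hqv (i) : Ω (q i) v = 0 := by rw [← hΩ.neg_eq, hvq, neg_zero]
    cases i using Fin.cases <;> cases j using Fin.cases <;> simp [h.right, hΩ.self_eq_zero, hvq, hqv]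
  pairing i j := by
    cases i using Fin.cases <;> cases j using Fin.cases <;>
      simp [h.pairing, huv, huq, hpv, Fin.succ_ne_zero, (Fin.succ_ne_zero _).symm]

/-- For an alternating bilinear form, the space is the sum of the span of a symplectic family and
of the radical. -/
theorem exists_isSymplecticFamily [FiniteDimensional ℝ V] (Ω : LinearMap.BilinForm ℝ V)
    (hΩ : Ω.IsAlt) : ∃ (m : ℕ) (p q : Fin m → V), IsSymplecticFamily Ω p q ∧
      ∀ v, ∃ (x y : Fin m → ℝ) (v' : V), (∀ w, Ω v' w = 0) ∧
        v = ∑ i, x i • p i + ∑ i, y i • q i + v' := by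
  classical
  let P (m : ℕ) : Prop := ∃ p q : Fin m → V, IsSymplecticFamily Ω p q
  have h0 : P 0 := ⟨Fin.elim0, Fin.elim0, ⟨fun i ↦ i.elim0, fun i ↦ i.elim0, fun i ↦ i.elim0⟩⟩
  -- A symplectic family of maximal size: a vector orthogonal to it but outside the radical would
  -- enlarge it.
  set m := Nat.findGreatest P (Module.finrank ℝ V) with hm
  obtain ⟨p, q, hpq⟩ : P m := Nat.findGreatest_spec (Nat.zero_le _) h0
  have hmax : ¬ P (m + 1) := by
    intro h
    obtain ⟨p', q', h'⟩ := id h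
    exact Nat.findGreatest_is_greatest (Nat.lt_succ_self m) (h'.le_finrank) h
  have hdec (v : V) : ∃ (x y : Fin m → ℝ) (v' : V), (∀ i, Ω (p i) v' = 0) ∧ (∀ i, Ω v' (q i) = 0) ∧
      v = ∑ i, x i • p i + ∑ i, y i • q i + v' := by
    refine ⟨fun i ↦ Ω v (q i), fun i ↦ Ω (p i) v, v - (∑ i, Ω v (q i) • p i +
      ∑ i, Ω (p i) v • q i), fun i ↦ ?_, fun i ↦ ?_, by abel⟩
    · rw [map_sub, hpq.apply_left_sum, sub_self]
    · rw [map_sub, LinearMap.sub_apply, hpq.apply_sum_right, sub_self]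
  refine ⟨m, p, q, hpq, fun v ↦ ?_⟩
  obtain ⟨x, y, v', hpv, hvq, hv⟩ := hdec v
  refine ⟨x, y, v', fun w ↦ ?_, hv⟩
  obtain ⟨a, b, w', hpw, hwq, rfl⟩ := hdec w
  have hvp (i) : Ω v' (p i) = 0 := by rw [← hΩ.neg_eq, hpv, neg_zero]
  by_contra hne
  have hvw : Ω v' w' ≠ 0 := by
    intro h
    simp [h, hvp, hvq] at hne
  refine hmax ⟨_, _, hpq.cons hΩ hpv hvq (v := (Ω v' w')⁻¹ • w') ?_ ?_ ?_⟩
  · simp [hpw]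
  · simp [hwq]
  · simp [hvw]

end Symplectic

/-! ### Lie algebras with brackets on a central line -/

section Heisenberg

variable {K : Type*} [LieRing K] [LieAlgebra ℝ K]

/-- The morphism from the Heisenberg Lie algebra given by a symplectic family. -/
def heisenbergHom {Ω : LinearMap.BilinForm ℝ K} (hΩ : Ω.IsAlt) {m : ℕ} {p q : Fin m → K}
    (h : IsSymplecticFamily Ω p q) {e : K} (hlie : ∀ z w : K, ⁅z, w⁆ = Ω z w • e)
    (hr : ∀ z, Ω z e = 0) : HeisenbergAlgebra m →ₗ⁅ℝ⁆ K where
  toFun a := ∑ i, a.x i • p i + ∑ i, a.y i • q i + a.z • e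
  map_add' a b := by
    simp only [HeisenbergAlgebra.add_x, HeisenbergAlgebra.add_y, HeisenbergAlgebra.add_z,
      Pi.add_apply, add_smul, Finset.sum_add_distrib]
    abel
  map_smul' c a := by
    simp only [HeisenbergAlgebra.smul_x, HeisenbergAlgebra.smul_y, HeisenbergAlgebra.smul_z,
      Pi.smul_apply, smul_eq_mul, mul_smul, Finset.smul_sum, smul_add, RingHom.id_apply]
  map_lie' {a b} := by
    have hl (z : K) : Ω e z = 0 := by rw [← hΩ.neg_eq, hr, neg_zero]
    have hqp (i j) : Ω (q i) (p j) = if j = i then -1 else 0 := by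
      rw [← hΩ.neg_eq, h.pairing]
      split_ifs <;> simp
    rw [hlie]
    simp [hr, hl, h.left, h.right, h.pairing, hqp, dotProduct, sub_eq_add_neg, mul_comm]

/-- The bracket is `Ω • e` with `Ω = φ ∘ [·, ·]` and `φ e = 1`. The radical of `Ω` is the centre and
contains `e`: the Heisenberg ideal takes `e` and a symplectic family, the Abelian one is the kernel
of `φ` in the radical. -/
theorem isHeisenbergPlusAbelian_of_lie_eq_smul [FiniteDimensional ℝ K] {e : K} (he : e ≠ 0)
    (hze : ∀ z : K, ⁅z, e⁆ = 0) (hlie : ∀ z w : K, ∃ c : ℝ, ⁅z, w⁆ = c • e)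
    (hne : ∃ z w : K, ⁅z, w⁆ ≠ 0) : IsHeisenbergPlusAbelian K := by
  obtain ⟨φ, hφ⟩ : ∃ φ : Module.Dual ℝ K, φ e = 1 :=
    Module.Projective.exists_dual_eq_one ℝ he
  let Ω : LinearMap.BilinForm ℝ K := (LieModule.toEnd ℝ K K : K →ₗ[ℝ] K →ₗ[ℝ] K).compr₂ φ
  have hΩ_apply (z w : K) : Ω z w = φ ⁅z, w⁆ := rfl
  have hΩ : Ω.IsAlt := fun z ↦ by rw [hΩ_apply, lie_self, map_zero]
  have hlie' (z w : K) : ⁅z, w⁆ = Ω z w • e := by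
    obtain ⟨c, hc⟩ := hlie z w
    rw [hΩ_apply, hc, map_smul, hφ, smul_eq_mul, mul_one]
  have hr (z : K) : Ω z e = 0 := by rw [hΩ_apply, hze, map_zero]
  obtain ⟨m, p, q, hpq, hdec⟩ := exists_isSymplecticFamily Ω hΩ
  let ψ := heisenbergHom hΩ hpq hlie' hr
  have hψ (a : HeisenbergAlgebra m) :
      ψ a = ∑ i, a.x i • p i + ∑ i, a.y i • q i + a.z • e := rfl
  have hl (z : K) : Ω e z = 0 := by rw [← hΩ.neg_eq, hr, neg_zero]
  have hx (a : HeisenbergAlgebra m) (j) : Ω (ψ a) (q j) = a.x j := by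
    rw [hψ, map_add, LinearMap.add_apply, hpq.apply_sum_right]
    simp [hl]
  have hy (a : HeisenbergAlgebra m) (j) : Ω (p j) (ψ a) = a.y j := by
    rw [hψ, map_add, hpq.apply_left_sum]
    simp [hr]
  have hzero (a : HeisenbergAlgebra m) (h : ∀ w, Ω (ψ a) w = 0) : ψ a = a.z • e := by
    have h1 (j) : a.x j = 0 := by rw [← hx, h]
    have h2 (j) : a.y j = 0 := by rw [← hy, ← hΩ.neg_eq, h, neg_zero]
    simp [hψ, h1, h2]
  have hinj : Function.Injective ψ := by
    refine (injective_iff_map_eq_zero ψ).2 fun a ha ↦ ?_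
    have hz := hzero a (by simp [ha])
    rw [ha, eq_comm, smul_eq_zero] at hz
    ext j
    · rw [← hx, ha]; simp
    · rw [← hy, ha]; simp
    · exact hz.resolve_right he
  have hψe (c : ℝ) : ψ ⟨0, 0, c⟩ = c • e := by simp [hψ]
  have hm : 1 ≤ m := by
    by_contra! hm
    obtain rfl : m = 0 := by omega
    obtain ⟨z, w, hzw⟩ := hne
    obtain ⟨x, y, v', hv', rfl⟩ := hdec z
    exact hzw (by rw [hlie']; simp [hv'])
  let I : LieIdeal ℝ K :=
    { LinearMap.range (ψ : HeisenbergAlgebra m →ₗ[ℝ] K) with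
      lie_mem := fun {z w} _ ↦ ⟨⟨0, 0, Ω z w⟩, by rw [hlie']; exact hψe _⟩ }
  let J : LieIdeal ℝ K :=
    { LinearMap.ker φ ⊓ LinearMap.ker Ω with
      lie_mem := fun {z w} hw ↦ by
        have hw : Ω w = 0 := hw.2
        have : ⁅z, w⁆ = 0 := by rw [hlie', ← hΩ.neg_eq, hw]; simp
        rw [this]
        exact Submodule.zero_mem _ }
  have hI (v : K) : v ∈ I ↔ ∃ a, ψ a = v := Iff.rfl
  have hJ (v : K) : v ∈ J ↔ φ v = 0 ∧ Ω v = 0 := Iff.rfl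
  refine ⟨m, hm, I, J, ⟨?_, ?_⟩, ⟨LieEquiv.symm ?_⟩, ?_⟩
  · rw [disjoint_iff, LieSubmodule.eq_bot_iff]
    intro v hv
    obtain ⟨a, rfl⟩ := (hI v).1 hv.1
    obtain ⟨hv1, hv2⟩ := (hJ _).1 hv.2
    have h := hzero a (by simp [hv2])
    rw [h, map_smul, hφ, smul_eq_mul, mul_one] at hv1
    exact h.trans (by rw [hv1, zero_smul])
  · rw [codisjoint_iff, eq_top_iff]
    rintro v -
    obtain ⟨x, y, v', hv', rfl⟩ := hdec v
    rw [LieSubmodule.mem_sup]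
    -- The radical part splits as `v' = φ v' • e + (v' - φ v' • e)`.
    refine ⟨ψ ⟨x, y, φ v'⟩, ⟨_, rfl⟩, v' - φ v' • e, (hJ _).2 ⟨by simp [hφ], ?_⟩, ?_⟩
    · ext w
      simp [hv', hl]
    · rw [hψ]
      abel
  · let f : HeisenbergAlgebra m ≃ₗ[ℝ] I.toSubmodule :=
      LinearEquiv.ofInjective (ψ : HeisenbergAlgebra m →ₗ[ℝ] K) hinj
    exact { f with map_lie' := fun {a b} ↦ Subtype.ext (ψ.map_lie a b) }
  · refine ⟨fun v w ↦ Subtype.ext ?_⟩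
    have hv := ((hJ _).1 v.2).2
    change ⁅(v : K), (w : K)⁆ = 0
    rw [hlie', hv]
    simp

end Heisenberg

/-! ### The dichotomy: central or noncentral derived ideal -/

section Classification

variable {L : Type*} [LieRing L] [LieAlgebra ℝ L]

/-- In an Abelian algebra all subspaces are ideals, so a line and a complement would decompose it.
-/
lemma IsNondecomposable.exists_lie_ne_zero [FiniteDimensional ℝ L] (hdec : IsNondecomposable L)
    (hdim : 2 ≤ Module.finrank ℝ L) : ∃ x y : L, ⁅x, y⁆ ≠ 0 := by
  by_contra! hab
  have : Nontrivial L := Module.nontrivial_of_finrank_pos (R := ℝ) (by omega)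
  obtain ⟨v, hv⟩ := exists_ne (0 : L)
  obtain ⟨C, hC⟩ := Submodule.exists_isCompl (ℝ ∙ v)
  let toIdeal (S : Submodule ℝ L) : LieIdeal ℝ L :=
    { S with lie_mem := fun {x y} _ ↦ by rw [hab]; exact S.zero_mem }
  have hcompl : IsCompl (toIdeal (ℝ ∙ v)) (toIdeal C) := by
    rwa [← LieSubmodule.isCompl_toSubmodule]
  rcases hdec _ _ hcompl with h | h
  · have hmem : v ∈ toIdeal (ℝ ∙ v) := Submodule.mem_span_singleton_self v
    rw [h] at hmem
    exact hv ((LieSubmodule.mem_bot v).1 hmem)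
  · have hC0 : C = ⊥ := congrArg LieSubmodule.toSubmodule h
    have htop : (ℝ ∙ v) = ⊤ := by simpa [hC0] using hC.sup_eq_top
    have h1 := finrank_span_singleton (K := ℝ) hv
    rw [htop, finrank_top] at h1
    omega

/-- A nondecomposable solvable Lie algebra, whose derived algebra acts by skew-symmetric operators
for a Lorentzian form, is `2`-step nilpotent, or of derived length `3` with derived algebra the
direct sum of a Heisenberg algebra and an Abelian one. -/
theorem nilpotencyLength_eq_two_or_of_skew [FiniteDimensional ℝ L] (hdec : IsNondecomposable L)
    (hsolv : LieAlgebra.IsSolvable L) (hdim : 2 ≤ Module.finrank ℝ L)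
    {B : LinearMap.BilinForm ℝ L} (hsymm : ∀ v w, B v w = B w v)
    (hnd : ∀ v, (∀ w, B v w = 0) → v = 0)
    (hLor : ∃ v, B v v ≠ 0 ∧ ∀ w, w ≠ 0 → B v w = 0 → B v v * B w w < 0)
    (hskew : ∀ x y a b : L, B ⁅⁅x, y⁆, a⁆ b = -B a ⁅⁅x, y⁆, b⁆) :
    LieModule.nilpotencyLength L L = 2 ∨
      (LieAlgebra.derivedLength ℝ L = 3 ∧
        IsHeisenbergPlusAbelian (⁅(⊤ : LieIdeal ℝ L), (⊤ : LieIdeal ℝ L)⁆ : LieIdeal ℝ L)) := by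
  have hskew' : ∀ z ∈ ⁅(⊤ : LieIdeal ℝ L), (⊤ : LieIdeal ℝ L)⁆, ∀ a b : L,
      B ⁅z, a⁆ b = -B a ⁅z, b⁆ := by
    intro z hz a b
    rw [← LieSubmodule.mem_toSubmodule, LieSubmodule.lieIdeal_oper_eq_linear_span'] at hz
    induction hz using Submodule.span_induction with
    | mem _ h =>
      obtain ⟨x, -, y, -, rfl⟩ := h
      exact hskew x y a b
    | zero => simp
    | add u v _ _ hu hv =>
      simp only [add_lie, map_add, LinearMap.add_apply, hu, hv]
      ring
    | smul c u _ hu => simp [hu]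
  by_cases hc : ∃ z ∈ ⁅(⊤ : LieIdeal ℝ L), (⊤ : LieIdeal ℝ L)⁆, ∃ w : L, ⁅z, w⁆ ≠ 0
  · right
    obtain ⟨e, heD, he, hze, hlie, hne⟩ :=
      LieAlgebra.exists_derived_of_skew_of_not_central hsymm hnd hLor hskew' hc
    set D : LieIdeal ℝ L := ⁅(⊤ : LieIdeal ℝ L), (⊤ : LieIdeal ℝ L)⁆ with hD
    have hD2 : LieAlgebra.derivedSeriesOfIdeal ℝ L 2 ⊤ = ⁅D, D⁆ := by
      simp [LieAlgebra.derivedSeriesOfIdeal_succ, hD]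
    have hline (v : L) (hv : v ∈ ⁅D, D⁆) : ∃ c : ℝ, v = c • e := by
      have hle : ⁅D, D⁆.toSubmodule ≤ ℝ ∙ e := by
        rw [LieSubmodule.lieIdeal_oper_eq_linear_span', Submodule.span_le]
        rintro _ ⟨z, hz, w, hw, rfl⟩
        obtain ⟨c, h⟩ := hlie z hz w hw
        exact Submodule.mem_span_singleton.2 ⟨c, h.symm⟩
      obtain ⟨c, h⟩ := Submodule.mem_span_singleton.1 (hle hv)
      exact ⟨c, h.symm⟩
    obtain ⟨z, hz, w, hw, hzw⟩ := hne
    refine ⟨?_, ?_⟩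
    -- Length 3 means that the second derived ideal `[D, D]` is Abelian and nonzero.
    · rw [LieAlgebra.derivedLength, LieAlgebra.derivedSeries_of_derivedLength_succ, hD2]
      refine ⟨⟨fun u v ↦ Subtype.ext ?_⟩, fun h ↦ hzw ?_⟩
      · obtain ⟨a, ha⟩ := hline u u.2
        obtain ⟨b, hb⟩ := hline v v.2
        change ⁅(u : L), (v : L)⁆ = 0
        rw [ha, hb, smul_lie, lie_smul, lie_self, smul_zero, smul_zero]
      · have hmem : ⁅z, w⁆ ∈ ⁅D, D⁆ := LieSubmodule.lie_mem_lie hz hw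
        rwa [h, LieSubmodule.mem_bot] at hmem
    · refine isHeisenbergPlusAbelian_of_lie_eq_smul (e := (⟨e, heD⟩ : D))
        (fun h ↦ he (congrArg Subtype.val h)) (fun u ↦ Subtype.ext (hze u u.2)) (fun u v ↦ ?_)
        ⟨⟨z, hz⟩, ⟨w, hw⟩, fun h ↦ hzw (congrArg Subtype.val h)⟩
      obtain ⟨c, h⟩ := hlie u u.2 v v.2
      exact ⟨c, Subtype.ext h⟩
  · left
    push Not at hc
    rw [LieModule.nilpotencyLength_eq_succ_iff ℝ]
    simp only [LieModule.lowerCentralSeries_succ, LieModule.lowerCentralSeries_zero]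
    constructor
    · rw [LieSubmodule.lie_eq_bot_iff]
      intro x _ y hy
      rw [← lie_skew, hc y hy, neg_zero]
    · intro h
      obtain ⟨x, y, hxy⟩ := hdec.exists_lie_ne_zero hdim
      exact hxy ((LieSubmodule.lie_eq_bot_iff _ _).1 h x (LieSubmodule.mem_top x) y
        (LieSubmodule.mem_top y))

end Classification

theorem mainTheorem6
    {E : Type*} [NormedAddCommGroup E] [NormedSpace ℝ E] [FiniteDimensional ℝ E]
    {G : Type*} [TopologicalSpace G] [ChartedSpace E G] [Group G] [LieGroup 𝓘(ℝ, E) ∞ G]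
    (hdec : IsNondecomposable (GroupLieAlgebra 𝓘(ℝ, E) G))
    (hsolv : LieAlgebra.IsSolvable (GroupLieAlgebra 𝓘(ℝ, E) G))
    (μ : PseudoRiemannianMetric E G)
    (hμ : IsCartanSchoutenMetric μ) (hLor : μ.IsLorentzian) :
    (LieModule.nilpotencyLength (GroupLieAlgebra 𝓘(ℝ, E) G) (GroupLieAlgebra 𝓘(ℝ, E) G) = 2 ∨
      LieModule.nilpotencyLength (GroupLieAlgebra 𝓘(ℝ, E) G) (GroupLieAlgebra 𝓘(ℝ, E) G) = 3) ∨
    (LieAlgebra.derivedLength ℝ (GroupLieAlgebra 𝓘(ℝ, E) G) = 3 ∧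
      IsHeisenbergPlusAbelian
        (⁅(⊤ : LieIdeal ℝ (GroupLieAlgebra 𝓘(ℝ, E) G)),
          (⊤ : LieIdeal ℝ (GroupLieAlgebra 𝓘(ℝ, E) G))⁆ :
            LieIdeal ℝ (GroupLieAlgebra 𝓘(ℝ, E) G))) := by
  have hfin : FiniteDimensional ℝ (GroupLieAlgebra 𝓘(ℝ, E) G) :=
    inferInstanceAs (FiniteDimensional ℝ E)
  obtain ⟨hdim, hsymm, hv⟩ := hLor 1
  let B : LinearMap.BilinForm ℝ (GroupLieAlgebra 𝓘(ℝ, E) G) :=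
    (ContinuousLinearMap.coeLM ℝ).comp (μ.form 1).toLinearMap
  -- Class 3 never occurs: the nilpotent case always has class 2.
  rw [or_assoc, or_left_comm]
  exact .inr (nilpotencyLength_eq_two_or_of_skew hdec hsolv hdim (B := B) hsymm
    (μ.nondegenerate 1) hv hμ.form_lie_lie)
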